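/- Let $n\ge 1$ and let $\mathcal{L}_n=\bigoplus_{k\ge 1}\mathcal{L}_n(k)$ be the free Lie algebra over $\mathbb{Z}$ on $x_1,\dots,x_n$, graded so that each $x_i$ has degree $1$. For $k\ge 1$ let $\mathfrak{b}_n(k)$ be the $\mathbb{Z}$-module of all derivations $D$ of $\mathcal{L}_n$ such that for every $i$ there is $C_i\in\mathcal{L}_n(k)$ with $D(x_i)=[C_i,x_i]$, and such that $\sum_{i=1}^n D(x_i)=0$. Let $\mathfrak{b}_n=\bigoplus_{k\ge 1}\mathfrak{b}_n(k)$, a graded Lie subalgebra of $\mathrm{Der}(\mathcal{L}_n)$ (the special derivation Lie algebra), let $H_1(\mathfrak{b}_n,\mathbb{Z})=\mathfrak{b}_n/[\mathfrak{b}_n,\mathfrak{b}_n]$ be its abelianization, and let $H_1(\mathfrak{b}_n,\mathbb{Z})_k$ be the degree $k$ part of it, i.e. the image of $\mathfrak{b}_n(k)$. **Theorem.** For every $n\ge 3$ and every odd $k\ge 3$, $$\operatorname{rank}_{\mathbb{Z}} H_1(\mathfrak{b}_n,\mathbb{Z})_k\;\ge\;\binom{n+k-1}{k}-\frac{n(n+1)}{2}.$$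 In particular, for every $n\ge 3$, $H_1(\mathfrak{b}_n,\mathbb{Z})$ is not finitely generated as a $\mathbb{Z}$-module. -/

import Mathlib

noncomputable section

namespace SpecialDer

/-- The free Lie algebra `𝓛_n` over `ℤ` on `x_1, …, x_n`. -/
abbrev FreeLie (n : ℕ) : Type := FreeLieAlgebra ℤ (Fin n)

/-- The generator `x_i` of `𝓛_n`. -/
def gen (n : ℕ) (i : Fin n) : FreeLie n := FreeLieAlgebra.of ℤ i

/-- The homogeneous component `𝓛_n(k)`: `𝓛_n(1) = H` is spanned by the generators and
`𝓛_n(k+1) = [𝓛_n(k), H]`, i.e. `𝓛_n(k)` is spanned by the left-normed brackets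
`[x_{j_1}, …, x_{j_k}]`. There is no component in degree `0`. -/
def freeLieDeg (n : ℕ) : ℕ → Submodule ℤ (FreeLie n)
  | 0 => ⊥
  | 1 => Submodule.span ℤ (Set.range (gen n))
  | (k + 2) => Submodule.span ℤ {z | ∃ u ∈ freeLieDeg n (k + 1), ∃ i : Fin n, z = ⁅u, gen n i⁆}

/-- The Lie algebra `Der(𝓛_n)` of all `ℤ`-linear derivations of `𝓛_n`, with
`[D, E] = D ∘ E - E ∘ D`. -/
abbrev Der (n : ℕ) : Type := LieDerivation ℤ (FreeLie n) (FreeLie n)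

/-- The degree `k` part `Der(𝓛_n)(k)`: derivations carrying `H = 𝓛_n(1)` into `𝓛_n(k+1)`. -/
def derDeg (n k : ℕ) : Submodule ℤ (Der n) where
  carrier := {D | ∀ x ∈ freeLieDeg n 1, D x ∈ freeLieDeg n (k + 1)}
  zero_mem' := fun x _ => by simp
  add_mem' := fun hD hE x hx => by
    simpa using add_mem (hD x hx) (hE x hx)
  smul_mem' := fun c D hD x hx => by
    simpa using Submodule.smul_mem _ c (hD x hx)

/-- The degree `k` tangential derivations `𝔭_n(k)`: sums of elements
`x_i^* ⊗ [x_{j_1}, …, x_{j_k}, x_i]`, that is, derivations of degree `k` with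
`D x_i = [C_i, x_i]`, `C_i ∈ 𝓛_n(k)`, for every `i`. -/
def tangDeg (n k : ℕ) : Submodule ℤ (Der n) where
  carrier := {D | D ∈ derDeg n k ∧ ∀ i, ∃ c ∈ freeLieDeg n k, D (gen n i) = ⁅c, gen n i⁆}
  zero_mem' := ⟨zero_mem _, fun i => ⟨0, zero_mem _, by simp⟩⟩
  add_mem' := by
    rintro D E ⟨hD, hD'⟩ ⟨hE, hE'⟩
    refine ⟨add_mem hD hE, fun i => ?_⟩
    obtain ⟨c, hc, h1⟩ := hD' i
    obtain ⟨d, hd, h2⟩ := hE' i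
    exact ⟨c + d, add_mem hc hd, by simp [h1, h2]⟩
  smul_mem' := by
    rintro a D ⟨hD, hD'⟩
    refine ⟨Submodule.smul_mem _ a hD, fun i => ?_⟩
    obtain ⟨c, hc, h1⟩ := hD' i
    exact ⟨a • c, Submodule.smul_mem _ a hc, by simp [h1]⟩

/-- The degree `k` special derivations `𝔟_n(k)`: tangential derivations `∑ x_i^* ⊗ C_i` of degree
`k` with `∑ C_i = 0`. -/
def specDeg (n k : ℕ) : Submodule ℤ (Der n) where
  carrier := {D | D ∈ tangDeg n k ∧ ∑ i, D (gen n i) = 0}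
  zero_mem' := ⟨zero_mem _, by simp⟩
  add_mem' := by
    rintro D E ⟨hD, hD'⟩ ⟨hE, hE'⟩
    exact ⟨add_mem hD hE, by simp [Finset.sum_add_distrib, hD', hE']⟩
  smul_mem' := by
    rintro a D ⟨hD, hD'⟩
    exact ⟨Submodule.smul_mem _ a hD, by
      simp only [LieDerivation.smul_apply, ← Finset.smul_sum, hD', smul_zero]⟩

theorem gen_mem (n : ℕ) (i : Fin n) : gen n i ∈ freeLieDeg n 1 :=
  Submodule.subset_span ⟨i, rfl⟩

theorem lie_gen_mem {n k : ℕ} {u : FreeLie n} (hu : u ∈ freeLieDeg n k) (i : Fin n) :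
    ⁅u, gen n i⁆ ∈ freeLieDeg n (k + 1) := by
  cases k with
  | zero =>
    have : u = 0 := by simpa [freeLieDeg] using hu
    simp [this]
  | succ k => exact Submodule.subset_span ⟨u, hu, i, rfl⟩

theorem lie_mem {n : ℕ} (l : ℕ) : ∀ {k : ℕ} {u v : FreeLie n}, u ∈ freeLieDeg n k →
    v ∈ freeLieDeg n l → ⁅u, v⁆ ∈ freeLieDeg n (k + l) := by
  induction l with
  | zero =>
    intro k u v _ hv
    have : v = 0 := by simpa [freeLieDeg] using hv
    simp [this]
  | succ l ih =>
    intro k u v hu hv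
    cases l with
    | zero =>
      refine Submodule.span_induction (p := fun v _ => ⁅u, v⁆ ∈ freeLieDeg n (k + 1))
        ?_ ?_ ?_ ?_ hv
      · rintro _ ⟨i, rfl⟩
        exact lie_gen_mem hu i
      · simp
      · intro x y _ _ hx hy
        simpa using add_mem hx hy
      · intro a x _ hx
        simpa using Submodule.smul_mem _ a hx
    | succ l =>
      refine Submodule.span_induction (p := fun v _ => ⁅u, v⁆ ∈ freeLieDeg n (k + (l + 2)))
        ?_ ?_ ?_ ?_ hv
      · rintro _ ⟨w, hw, i, rfl⟩
        rw [leibniz_lie, ← lie_skew w]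
        have h1 := lie_gen_mem (ih hu hw) i
        have h2 := ih (lie_gen_mem hu i) hw
        have e : k + 1 + (l + 1) = k + (l + 2) := by omega
        rw [e] at h2
        exact add_mem h1 (Submodule.neg_mem _ h2)
      · simp
      · intro x y _ _ hx hy
        simpa using add_mem hx hy
      · intro a x _ hx
        simpa using Submodule.smul_mem _ a hx

theorem der_mem {n k : ℕ} {D : Der n} (hD : D ∈ derDeg n k) (m : ℕ) :
    ∀ {u : FreeLie n}, u ∈ freeLieDeg n m → D u ∈ freeLieDeg n (m + k) := by
  induction m with
  | zero =>
    intro u hu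
    have : u = 0 := by simpa [freeLieDeg] using hu
    simp [this]
  | succ m ih =>
    intro u hu
    cases m with
    | zero =>
      have := hD u hu
      rwa [add_comm] at this
    | succ m =>
      refine Submodule.span_induction (p := fun u _ => D u ∈ freeLieDeg n (m + 2 + k))
        ?_ ?_ ?_ ?_ hu
      · rintro _ ⟨w, hw, i, rfl⟩
        rw [LieDerivation.apply_lie_eq_add]
        have h1 := lie_mem _ hw (hD _ (gen_mem n i))
        have h2 := lie_gen_mem (ih hw) i
        have e1 : m + 1 + (k + 1) = m + 2 + k := by omega
        have e2 : m + 1 + k + 1 = m + 2 + k := by omega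
        rw [e1] at h1
        rw [e2] at h2
        exact add_mem h1 h2
      · simp
      · intro x y _ _ hx hy
        simpa using add_mem hx hy
      · intro a x _ hx
        simpa using Submodule.smul_mem _ a hx

theorem spec_lie_mem {n k l : ℕ} {D E : Der n} (hD : D ∈ specDeg n k) (hE : E ∈ specDeg n l) :
    ⁅D, E⁆ ∈ specDeg n (k + l) := by
  obtain ⟨⟨hD1, hD2⟩, hD3⟩ := hD
  obtain ⟨⟨hE1, hE2⟩, hE3⟩ := hE
  refine ⟨⟨fun x hx => ?_, fun i => ?_⟩, ?_⟩
  · rw [LieDerivation.commutator_apply]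
    have h1 := der_mem hD1 _ (hE1 x hx)
    have h2 := der_mem hE1 _ (hD1 x hx)
    have e1 : l + 1 + k = k + l + 1 := by omega
    have e2 : k + 1 + l = k + l + 1 := by omega
    rw [e1] at h1
    rw [e2] at h2
    exact sub_mem h1 h2
  · obtain ⟨c, hc, h1⟩ := hD2 i
    obtain ⟨d, hd, h2⟩ := hE2 i
    refine ⟨D d - E c + ⁅d, c⁆, ?_, ?_⟩
    · have a1 := der_mem hD1 _ hd
      have a2 := der_mem hE1 _ hc
      have a3 := lie_mem _ hd hc
      rw [add_comm l k] at a1 a3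
      exact add_mem (sub_mem a1 a2) a3
    · rw [LieDerivation.commutator_apply, h2, h1, LieDerivation.apply_lie_eq_add,
        LieDerivation.apply_lie_eq_add, h1, h2, add_lie, sub_lie, lie_lie d c]
      abel
  · simp only [LieDerivation.commutator_apply, Finset.sum_sub_distrib, ← map_sum, hD3, hE3,
      map_zero, sub_zero]

/-- The special derivation Lie algebra `𝔟_n = ⨁_{k ≥ 1} 𝔟_n(k)`, as a Lie subalgebra of
`Der(𝓛_n)`. -/
def specialLie (n : ℕ) : LieSubalgebra ℤ (Der n) where
  toSubmodule := ⨆ k : ℕ, specDeg n (k + 1)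
  lie_mem' := by
    intro D E hD hE
    refine Submodule.iSup_induction (fun k : ℕ => specDeg n (k + 1))
      (motive := fun D => ⁅D, E⁆ ∈ ⨆ k : ℕ, specDeg n (k + 1)) hD ?_ ?_ ?_
    · intro k D hD
      refine Submodule.iSup_induction (fun k : ℕ => specDeg n (k + 1))
        (motive := fun E => ⁅D, E⁆ ∈ ⨆ k : ℕ, specDeg n (k + 1)) hE ?_ ?_ ?_
      · intro l E hE
        have h := spec_lie_mem hD hE
        have e : k + 1 + (l + 1) = k + l + 1 + 1 := by omega
        rw [e] at h
        exact Submodule.mem_iSup_of_mem (k + l + 1) h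
      · simp
      · intro x y hx hy
        rw [lie_add]
        exact add_mem hx hy
    · simp
    · intro x y hx hy
      rw [add_lie]
      exact add_mem hx hy

/-- The abelianization `H_1(𝔟_n, ℤ) = 𝔟_n / [𝔟_n, 𝔟_n]`. -/
abbrev H1 (n : ℕ) : Type :=
  specialLie n ⧸ (⁅(⊤ : LieIdeal ℤ (specialLie n)), (⊤ : LieIdeal ℤ (specialLie n))⁆ :
    LieIdeal ℤ (specialLie n))

/-- The degree `k` part `H_1(𝔟_n, ℤ)_k`: the image of `𝔟_n(k)` in `H_1(𝔟_n, ℤ)`. -/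
def H1Deg (n k : ℕ) : Submodule ℤ (H1 n) :=
  ((specDeg n k).comap (specialLie n).toSubmodule.subtype).map
    (LieSubmodule.Quotient.mk' (⁅(⊤ : LieIdeal ℤ (specialLie n)),
      (⊤ : LieIdeal ℤ (specialLie n))⁆ : LieIdeal ℤ (specialLie n)) :
        specialLie n →ₗ[ℤ] H1 n)

end SpecialDer

end

noncomputable section

/-- The split extension of a Lie ring `L` by an `L`-module `M`, on which the bracket vanishes. -/
@[ext] structure SplitAbelianExt (L M : Type*) where
  /-- The component in the Lie ring. -/
  fst : L
  /-- The component in the module. -/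
  snd : M

namespace SplitAbelianExt

variable {L M : Type*}

/-- A split extension is a product as a set. -/
def toProd : SplitAbelianExt L M ≃ L × M where
  toFun x := (x.fst, x.snd)
  invFun x := ⟨x.1, x.2⟩

section Additive

variable [AddCommGroup L] [AddCommGroup M]

instance : AddCommGroup (SplitAbelianExt L M) := toProd.addCommGroup

@[simp] theorem add_fst (x y : SplitAbelianExt L M) : (x + y).fst = x.fst + y.fst := rfl
@[simp] theorem add_snd (x y : SplitAbelianExt L M) : (x + y).snd = x.snd + y.snd := rfl
@[simp] theorem neg_fst (x : SplitAbelianExt L M) : (-x).fst = -x.fst := rfl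
@[simp] theorem zero_fst : (0 : SplitAbelianExt L M).fst = 0 := rfl
@[simp] theorem zero_snd : (0 : SplitAbelianExt L M).snd = 0 := rfl

end Additive

variable [LieRing L] [AddCommGroup M] [LieRingModule L M]

instance : Bracket (SplitAbelianExt L M) (SplitAbelianExt L M) where
  bracket x y := ⟨⁅x.fst, y.fst⁆, ⁅x.fst, y.snd⁆ - ⁅y.fst, x.snd⁆⟩

@[simp] theorem lie_fst (x y : SplitAbelianExt L M) : ⁅x, y⁆.fst = ⁅x.fst, y.fst⁆ := rfl
@[simp] theorem lie_snd (x y : SplitAbelianExt L M) :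
    ⁅x, y⁆.snd = ⁅x.fst, y.snd⁆ - ⁅y.fst, x.snd⁆ := rfl

instance : LieRing (SplitAbelianExt L M) where
  add_lie _ _ _ := by ext <;> simp; abel
  lie_add _ _ _ := by ext <;> simp; abel
  lie_self _ := by ext <;> simp
  leibniz_lie x y z := by
    ext
    · simp
    · simp only [lie_snd, lie_fst, add_snd, lie_sub, lie_lie]
      abel

end SplitAbelianExt

namespace SpecialDer

open MvPolynomial

variable {n : ℕ}

@[elab_as_elim]
theorem freeLie_induction {p : FreeLie n → Prop} (gen : ∀ i, p (gen n i)) (zero : p 0)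
    (add : ∀ u v, p u → p v → p (u + v)) (neg : ∀ u, p u → p (-u))
    (lie : ∀ u v, p u → p v → p ⁅u, v⁆) (u : FreeLie n) : p u := by
  have zsmul : ∀ (c : ℤ) (v : FreeLie n), p v → p (c • v) := by
    intro c v hv
    induction c using Int.induction_on with
    | zero => simpa using zero
    | succ c ih => rw [add_smul, one_smul]; exact add _ _ ih hv
    | pred c ih => rw [sub_smul, one_smul, sub_eq_add_neg]; exact add _ _ ih (neg _ hv)
  let := FreeLieAlgebra.instLieAlgebra ℤ (Fin n)
  let S : LieSubalgebra ℤ (FreeLieAlgebra ℤ (Fin n)) :=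
    { carrier := {v | p v}
      add_mem' := add _ _
      zero_mem' := zero
      smul_mem' := fun c v hv => by
        have h := zsmul c v hv
        rwa [← int_smul_eq_zsmul LieAlgebra.toModule c v] at h
      lie_mem' := lie _ _ }
  let f : FreeLieAlgebra ℤ (Fin n) →ₗ⁅ℤ⁆ S := FreeLieAlgebra.lift ℤ fun i => ⟨_, gen i⟩
  have h : S.incl.comp f = LieHom.id := FreeLieAlgebra.hom_ext fun i => by
    rw [LieHom.comp_apply, FreeLieAlgebra.lift_of_apply]
    rfl
  have hu := LieHom.congr_fun h u
  rw [LieHom.id_apply, LieHom.comp_apply] at hu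
  exact hu ▸ (f u).2

section Derivation

variable {M : Type*} [AddCommGroup M] [LieRingModule (FreeLie n) M]

theorem der_ext [LieModule ℤ (FreeLie n) M] {D E : LieDerivation ℤ (FreeLie n) M}
    (h : ∀ i, D (gen n i) = E (gen n i)) : D = E := by
  ext u
  induction u using freeLie_induction with
  | gen i => exact h i
  | zero => simp
  | add u v hu hv => simp [hu, hv]
  | neg u hu => simp [hu]
  | lie u v hu hv => simp [hu, hv]

/-- The section of the split extension determined by values on the generators. -/
def liftSplit (f : Fin n → M) :
    FreeLieAlgebra ℤ (Fin n) →ₗ⁅ℤ⁆ SplitAbelianExt (FreeLie n) M :=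
  FreeLieAlgebra.lift ℤ fun i => ⟨gen n i, f i⟩

theorem liftSplit_gen (f : Fin n → M) (i : Fin n) : liftSplit f (gen n i) = ⟨gen n i, f i⟩ :=
  FreeLieAlgebra.lift_of_apply ..

theorem liftSplit_fst (f : Fin n → M) (u : FreeLie n) : (liftSplit f u).fst = u := by
  induction u using freeLie_induction with
  | gen i => simp [liftSplit_gen]
  | zero => simp
  | add u v hu hv => simp [hu, hv]
  | neg u hu => simp [hu]
  | lie u v hu hv => simp [hu, hv]

/-- The derivation of the free Lie algebra with prescribed values on the generators. -/
def derivation [LieModule ℤ (FreeLie n) M] (f : Fin n → M) : LieDerivation ℤ (FreeLie n) M where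
  toLinearMap := AddMonoidHom.toIntLinearMap
    { toFun := fun u => (liftSplit f u).snd
      map_zero' := by simp
      map_add' := fun u v => by simp }
  leibniz' u v := by simp [liftSplit_fst]

@[simp]
theorem derivation_gen [LieModule ℤ (FreeLie n) M] (f : Fin n → M) (i : Fin n) :
    derivation f (gen n i) = f i := by
  change (liftSplit f (gen n i)).snd = f i
  rw [liftSplit_gen]

end Derivation

/-- The additive map from the free Lie algebra to the polynomial ring which sends the generators to
the variables and vanishes on brackets. -/
def ab (n : ℕ) : FreeLie n →+ MvPolynomial (Fin n) ℤ :=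
  letI : LieRing (MvPolynomial (Fin n) ℤ) := LieRing.ofAssociativeRing
  (FreeLieAlgebra.lift ℤ (X : Fin n → MvPolynomial (Fin n) ℤ)).toLinearMap.toAddMonoidHom

@[simp]
theorem ab_gen (i : Fin n) : ab n (gen n i) = X i := by
  let : LieRing (MvPolynomial (Fin n) ℤ) := LieRing.ofAssociativeRing
  exact FreeLieAlgebra.lift_of_apply (R := ℤ) (X : Fin n → MvPolynomial (Fin n) ℤ) i

@[simp]
theorem ab_lie (u v : FreeLie n) : ab n ⁅u, v⁆ = 0 := by
  let : LieRing (MvPolynomial (Fin n) ℤ) := LieRing.ofAssociativeRing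
  refine (LieHom.map_lie (FreeLieAlgebra.lift ℤ (X : Fin n → MvPolynomial (Fin n) ℤ)) u v).trans ?_
  rw [LieRing.of_associative_ring_bracket, mul_comm, sub_self]

/-- The free Lie algebra acts on polynomials by multiplication through `ab`. -/
instance : LieRingModule (FreeLie n) (MvPolynomial (Fin n) ℤ) where
  bracket u p := ab n u * p
  add_lie u v p := by simp [add_mul]
  lie_add u p q := by simp [mul_add]
  leibniz_lie u v p := by
    simp only [ab_lie, zero_mul, zero_add]
    ring

theorem lie_poly (u : FreeLie n) (p : MvPolynomial (Fin n) ℤ) : ⁅u, p⁆ = ab n u * p := rfl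

instance : LieModule ℤ (FreeLie n) (MvPolynomial (Fin n) ℤ) where
  smul_lie c u p := by rw [lie_poly, lie_poly, map_zsmul, smul_mul_assoc]
  lie_smul c u p := by rw [lie_poly, lie_poly, mul_smul_comm]

/-- The abelianized Fox derivative with respect to the generator `x_i`. -/
def fox (i : Fin n) : LieDerivation ℤ (FreeLie n) (MvPolynomial (Fin n) ℤ) :=
  derivation fun j => if i = j then 1 else 0

theorem fox_gen (i j : Fin n) : fox i (gen n j) = if i = j then 1 else 0 :=
  derivation_gen _ _

theorem fox_lie (i : Fin n) (u v : FreeLie n) :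
    fox i ⁅u, v⁆ = ab n u * fox i v - ab n v * fox i u := by
  rw [LieDerivation.apply_lie_eq_sub, lie_poly, lie_poly]

/-- A derivation whose values on generators are killed by `ab` has all values killed by `ab`. -/
theorem ab_der {D : Der n} (hD : ∀ i, ab n (D (gen n i)) = 0) (u : FreeLie n) :
    ab n (D u) = 0 := by
  induction u using freeLie_induction with
  | gen i => exact hD i
  | zero => simp
  | add u v hu hv => simp [hu, hv]
  | neg u hu => simp [hu]
  | lie u v _ _ => rw [LieDerivation.apply_lie_eq_add, map_add, ab_lie, ab_lie, add_zero]

/-- The chain rule for abelianized Fox derivatives. -/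
theorem fox_der {D : Der n} (hD : ∀ i, ab n (D (gen n i)) = 0) (i : Fin n) (u : FreeLie n) :
    fox i (D u) = ∑ j, fox j u * fox i (D (gen n j)) := by
  let F : LieDerivation ℤ (FreeLie n) (MvPolynomial (Fin n) ℤ) :=
    { (fox i : FreeLie n →ₗ[ℤ] MvPolynomial (Fin n) ℤ) ∘ₗ (D : FreeLie n →ₗ[ℤ] FreeLie n) with
      leibniz' := fun u v => by
        change fox i (D ⁅u, v⁆) = ⁅u, fox i (D v)⁆ - ⁅v, fox i (D u)⁆
        simp only [LieDerivation.apply_lie_eq_add, map_add, fox_lie, ab_der hD, lie_poly]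
        ring }
  let G : LieDerivation ℤ (FreeLie n) (MvPolynomial (Fin n) ℤ) :=
    { ∑ j, (LinearMap.mulRight ℤ (fox i (D (gen n j)))) ∘ₗ
        (fox j : FreeLie n →ₗ[ℤ] MvPolynomial (Fin n) ℤ) with
      leibniz' := fun u v => by
        simp only [LinearMap.sum_apply,
          LinearMap.comp_apply, LinearMap.mulRight_apply, LieDerivation.coeFn_coe, fox_lie,
          lie_poly, Finset.mul_sum, ← Finset.sum_sub_distrib]
        exact Finset.sum_congr rfl fun _ _ => by ring }
  have hG : ∀ u, G u = ∑ j, fox j u * fox i (D (gen n j)) := fun u => by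
    change (∑ j, (LinearMap.mulRight ℤ (fox i (D (gen n j)))) ∘ₗ
        (fox j : FreeLie n →ₗ[ℤ] MvPolynomial (Fin n) ℤ)) u = _
    simp
  have h : F = G := der_ext fun k => by
    rw [hG]
    simp only [fox_gen, ite_mul, one_mul, zero_mul, Finset.sum_ite_eq', Finset.mem_univ, if_true]
    rfl
  rw [← hG, ← h]
  rfl

/-- The Morita trace: the abelianized divergence of a derivation. -/
def trace (n : ℕ) : Der n →ₗ[ℤ] MvPolynomial (Fin n) ℤ where
  toFun D := ∑ i, fox i (D (gen n i))
  map_add' D E := by simp [Finset.sum_add_distrib]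
  map_smul' c D := by simp [Finset.mul_sum]

theorem trace_apply (D : Der n) : trace n D = ∑ i, fox i (D (gen n i)) := rfl

theorem trace_lie {D E : Der n} (hD : ∀ i, ab n (D (gen n i)) = 0)
    (hE : ∀ i, ab n (E (gen n i)) = 0) : trace n ⁅D, E⁆ = 0 := by
  simp only [trace_apply, LieDerivation.commutator_apply, map_sub,
    fun i => fox_der hD i (E (gen n i)), fun i => fox_der hE i (D (gen n i)),
    Finset.sum_sub_distrib]
  rw [sub_eq_zero, Finset.sum_comm]
  simp only [mul_comm]

theorem ab_specialLie {D : Der n} (hD : D ∈ specialLie n) (i : Fin n) :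
    ab n (D (gen n i)) = 0 := by
  refine Submodule.iSup_induction (fun k : ℕ => specDeg n (k + 1))
    (motive := fun D => ab n (D (gen n i)) = 0) hD ?_ ?_ ?_
  · rintro k D ⟨⟨-, h⟩, -⟩
    obtain ⟨c, -, hc⟩ := h i
    rw [hc, ab_lie]
  · simp
  · intro D E hD hE
    simp [hD, hE]

/-- The trace of a class in the abelianization. -/
def traceH1 (n : ℕ) : H1 n →ₗ[ℤ] MvPolynomial (Fin n) ℤ :=
  Submodule.liftQ (⁅(⊤ : LieIdeal ℤ (specialLie n)), (⊤ : LieIdeal ℤ (specialLie n))⁆ :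
    LieIdeal ℤ (specialLie n)).toSubmodule (trace n ∘ₗ (specialLie n).toSubmodule.subtype) (by
      rw [LieSubmodule.lieIdeal_oper_eq_linear_span', Submodule.span_le]
      rintro _ ⟨D, -, E, -, rfl⟩
      exact trace_lie (ab_specialLie D.2) (ab_specialLie E.2))

theorem trace_mem_map {k : ℕ} {D : Der n} (hD : D ∈ specDeg n (k + 1)) :
    trace n D ∈ (H1Deg n (k + 1)).map (traceH1 n) :=
  ⟨_, ⟨⟨D, Submodule.mem_iSup_of_mem k hD⟩, hD, rfl⟩, rfl⟩

/-- The iterated bracket `[x_a, x_{y_m}, …, x_{y_1}]` for the list `y_1, …, y_m`. -/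
def iterBracket (a : Fin n) : List (Fin n) → FreeLie n
  | [] => gen n a
  | y :: ys => ⁅iterBracket a ys, gen n y⁆

theorem iterBracket_mem (a : Fin n) (ys : List (Fin n)) :
    iterBracket a ys ∈ freeLieDeg n (ys.length + 1) := by
  induction ys with
  | nil => exact gen_mem n a
  | cons y ys ih => exact lie_gen_mem ih y

/-- Joining the root of the tree of `iterBracket a ys` to the root of `v`, this is the family which
collects, for each label, the elements obtained by rooting at the leaves of the first tree. -/
def rootings (a : Fin n) : List (Fin n) → FreeLie n → Fin n → FreeLie n
  | [], v => Pi.single a v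
  | y :: ys, v => rootings a ys ⁅gen n y, v⁆ + Pi.single y ⁅v, iterBracket a ys⁆

theorem single_mem {k : ℕ} {v : FreeLie n} (hv : v ∈ freeLieDeg n k) (a i : Fin n) :
    (Pi.single a v : Fin n → FreeLie n) i ∈ freeLieDeg n k := by
  obtain rfl | h := eq_or_ne i a
  · simpa using hv
  · simp [h]

theorem rootings_mem (a : Fin n) (ys : List (Fin n)) {k : ℕ} {v : FreeLie n}
    (hv : v ∈ freeLieDeg n k) (i : Fin n) : rootings a ys v i ∈ freeLieDeg n (ys.length + k) := by
  induction ys generalizing k v with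
  | nil => simpa [rootings] using single_mem hv a i
  | cons y ys ih =>
    have h₁ := ih (lie_mem k (gen_mem n y) hv)
    have h₂ := lie_mem _ hv (iterBracket_mem a ys)
    rw [show ys.length + (1 + k) = (y :: ys).length + k by simp; omega] at h₁
    rw [show k + (ys.length + 1) = (y :: ys).length + k by simp; omega] at h₂
    exact add_mem h₁ (single_mem h₂ y i)

theorem sum_single_lie (a : Fin n) (v : FreeLie n) :
    ∑ i, ⁅(Pi.single a v : Fin n → FreeLie n) i, gen n i⁆ = ⁅v, gen n a⁆ := by
  rw [Finset.sum_eq_single a]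
  · simp
  · intro i _ h
    simp [h]
  · simp

theorem sum_rootings_lie (a : Fin n) (ys : List (Fin n)) (v : FreeLie n) :
    ∑ i, ⁅rootings a ys v i, gen n i⁆ = ⁅v, iterBracket a ys⁆ := by
  induction ys generalizing v with
  | nil => exact sum_single_lie a v
  | cons y ys ih =>
    simp only [rootings, iterBracket, Pi.add_apply, add_lie, Finset.sum_add_distrib, ih,
      sum_single_lie]
    rw [leibniz_lie v, ← lie_skew (iterBracket a ys) ⁅v, gen n y⁆, ← lie_skew v (gen n y), neg_lie]
    abel

/-- The coefficients of the special derivation attached to a caterpillar tree with end labels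
`a` and `b`. -/
def caterpillarCoeff (a : Fin n) (ys : List (Fin n)) (b : Fin n) : Fin n → FreeLie n :=
  rootings a ys (gen n b) + Pi.single b (iterBracket a ys)

/-- The special derivation attached to a caterpillar tree. -/
def caterpillar (a : Fin n) (ys : List (Fin n)) (b : Fin n) : Der n :=
  derivation fun i => ⁅caterpillarCoeff a ys b i, gen n i⁆

theorem caterpillar_gen (a : Fin n) (ys : List (Fin n)) (b i : Fin n) :
    caterpillar a ys b (gen n i) = ⁅caterpillarCoeff a ys b i, gen n i⁆ :=
  derivation_gen _ _

theorem caterpillarCoeff_mem (a : Fin n) (ys : List (Fin n)) (b i : Fin n) :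
    caterpillarCoeff a ys b i ∈ freeLieDeg n (ys.length + 1) :=
  add_mem (rootings_mem a ys (gen_mem n b) i) (single_mem (iterBracket_mem a ys) b i)

theorem caterpillar_mem (a : Fin n) (ys : List (Fin n)) (b : Fin n) :
    caterpillar a ys b ∈ specDeg n (ys.length + 1) := by
  refine ⟨⟨fun x hx => ?_, fun i => ⟨_, caterpillarCoeff_mem a ys b i, caterpillar_gen a ys b i⟩⟩,
    ?_⟩
  · refine Submodule.span_induction
      (p := fun x _ => caterpillar a ys b x ∈ freeLieDeg n (ys.length + 1 + 1)) ?_ ?_ ?_ ?_ hx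
    · rintro _ ⟨i, rfl⟩
      rw [caterpillar_gen]
      exact lie_gen_mem (caterpillarCoeff_mem a ys b i) i
    · simp
    · intro x y _ _ hx hy
      simpa using add_mem hx hy
    · intro c x _ hx
      simpa using Submodule.smul_mem _ c hx
  · simp only [caterpillar_gen, caterpillarCoeff, Pi.add_apply, add_lie, Finset.sum_add_distrib,
      sum_rootings_lie, sum_single_lie]
    rw [← lie_skew, neg_add_cancel]

/-- The weighted divergence `∑ x_i ∂_i C_i` of a family `C`. -/
def weightedDiv (n : ℕ) : (Fin n → FreeLie n) →+ MvPolynomial (Fin n) ℤ where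
  toFun C := ∑ i, X i * fox i (C i)
  map_zero' := by simp
  map_add' C D := by simp [mul_add, Finset.sum_add_distrib]

theorem weightedDiv_apply (C : Fin n → FreeLie n) :
    weightedDiv n C = ∑ i, X i * fox i (C i) := rfl

theorem weightedDiv_single (a : Fin n) (v : FreeLie n) :
    weightedDiv n (Pi.single a v) = X a * fox a v := by
  rw [weightedDiv_apply, Finset.sum_eq_single a]
  · simp
  · intro i _ h
    simp [h]
  · simp

theorem ab_iterBracket (a y : Fin n) (ys : List (Fin n)) :
    ab n (iterBracket a (y :: ys)) = 0 := by
  rw [iterBracket, ab_lie]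

theorem ab_single {v : FreeLie n} (hv : ab n v = 0) (a i : Fin n) :
    ab n ((Pi.single a v : Fin n → FreeLie n) i) = 0 := by
  obtain rfl | h := eq_or_ne i a
  · simpa using hv
  · simp [h]

theorem ab_rootings (a : Fin n) (ys : List (Fin n)) {v : FreeLie n} (hv : ab n v = 0)
    (i : Fin n) : ab n (rootings a ys v i) = 0 := by
  induction ys generalizing v with
  | nil => exact ab_single hv a i
  | cons y ys ih =>
    rw [rootings, Pi.add_apply, map_add, ih (ab_lie _ _), ab_single (ab_lie _ _), add_zero]

theorem ab_caterpillarCoeff (a y b : Fin n) (ys : List (Fin n)) (i : Fin n) :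
    ab n (caterpillarCoeff a (y :: ys) b i) = 0 := by
  rw [caterpillarCoeff, rootings, Pi.add_apply, Pi.add_apply, map_add, map_add,
    ab_rootings _ _ (ab_lie _ _), ab_single (ab_lie _ _), ab_single (ab_iterBracket _ _ _)]
  simp

theorem fox_iterBracket (i a z : Fin n) (l : List (Fin n)) :
    fox i (iterBracket a (l ++ [z])) =
      (-1) ^ l.length * (l.map X).prod * (X a * fox i (gen n z) - X z * fox i (gen n a)) := by
  induction l with
  | nil =>
    rw [List.nil_append, iterBracket, iterBracket, fox_lie]
    simp
  | cons y l ih =>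
    have h : ab n (iterBracket a (l ++ [z])) = 0 := by
      cases l <;> exact ab_iterBracket ..
    rw [List.cons_append, iterBracket, fox_lie, h, ih]
    simp
    ring

theorem weightedDiv_rootings (a z : Fin n) (l : List (Fin n)) {v : FreeLie n} (hv : ab n v = 0) :
    weightedDiv n (rootings a (l ++ [z]) v) =
      (l.map X).prod * (X a * X z * (fox a v - fox z v)) := by
  induction l generalizing v with
  | nil =>
    simp only [List.nil_append, rootings, iterBracket, map_add, weightedDiv_single, fox_lie, hv,
      ab_gen, List.map_nil, List.prod_nil]
    ring
  | cons y l ih =>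
    have h : ab n (iterBracket a (l ++ [z])) = 0 := by
      cases l <;> exact ab_iterBracket ..
    rw [List.cons_append, rootings, map_add, ih (ab_lie _ _), weightedDiv_single]
    simp only [fox_lie, hv, h, ab_gen, List.map_cons, List.prod_cons]
    ring

theorem trace_caterpillar (a y z : Fin n) (l : List (Fin n)) (hl : Even l.length)
    (hy : y ≠ a) (hz : z ≠ a) :
    trace n (caterpillar a (y :: (l ++ [z])) a) =
      -(2 * (l.map X).prod * (X a * X y * (X z + if y = z then X a else 0))) := by
  have h : ab n (iterBracket a (l ++ [z])) = 0 := by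
    cases l <;> exact ab_iterBracket ..
  have key : trace n (caterpillar a (y :: (l ++ [z])) a) =
      -weightedDiv n (caterpillarCoeff a (y :: (l ++ [z])) a) := by
    simp only [trace_apply, caterpillar_gen, fox_lie, ab_caterpillarCoeff, weightedDiv_apply,
      ab_gen, zero_mul, zero_sub, Finset.sum_neg_distrib]
  rw [key, caterpillarCoeff, map_add, rootings, map_add, weightedDiv_rootings _ _ _ (ab_lie _ _),
    weightedDiv_single, weightedDiv_single, iterBracket]
  simp only [fox_lie, fox_iterBracket, h, fox_gen, ab_gen, hl.neg_one_pow, hy, hz, hy.symm,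
    hz.symm, if_true, if_false]
  obtain rfl | h := eq_or_ne y z
  · simp only [if_true]
    ring
  · simp only [h, h.symm, if_false]
    ring

theorem freeLieDeg_fg (n k : ℕ) : (freeLieDeg n k).FG := by
  induction k with
  | zero => exact Submodule.fg_bot
  | succ k ih =>
    cases k with
    | zero => exact Submodule.fg_span (Set.finite_range _)
    | succ k =>
      have hfg : (⨆ i : Fin n, (freeLieDeg n (k + 1)).map
          (LieModule.toEnd ℤ (FreeLie n) (FreeLie n) (gen n i))).FG :=
        Submodule.fg_iSup _ fun i => ih.map _
      suffices h : freeLieDeg n (k + 2) = ⨆ i : Fin n, (freeLieDeg n (k + 1)).map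
          (LieModule.toEnd ℤ (FreeLie n) (FreeLie n) (gen n i)) from h ▸ hfg
      refine le_antisymm (Submodule.span_le.2 ?_) (iSup_le fun i => ?_)
      · rintro _ ⟨u, hu, i, rfl⟩
        refine Submodule.mem_iSup_of_mem i ⟨-u, neg_mem hu, ?_⟩
        simp
      · rintro _ ⟨u, hu, rfl⟩
        exact Submodule.subset_span ⟨-u, neg_mem hu, i, by simp⟩

instance (n k : ℕ) : Module.Finite ℤ (freeLieDeg n k) :=
  Module.Finite.iff_fg.2 (freeLieDeg_fg n k)

instance (n k : ℕ) : Module.Finite ℤ (specDeg n k) := by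
  let f : specDeg n k →ₗ[ℤ] Fin n → freeLieDeg n (k + 1) :=
    { toFun := fun D i => ⟨D.1 (gen n i), D.2.1.1 _ (gen_mem n i)⟩
      map_add' := fun _ _ => rfl
      map_smul' := fun _ _ => rfl }
  refine Module.Finite.of_injective f fun D E h => Subtype.ext (der_ext fun i => ?_)
  exact congrArg Subtype.val (congrFun h i)

instance (n k : ℕ) : Module.Finite ℤ (H1Deg n k) := by
  let f : (specDeg n k).comap (specialLie n).toSubmodule.subtype →ₗ[ℤ] specDeg n k :=
    { toFun := fun D => ⟨D.1.1, D.2⟩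
      map_add' := fun _ _ => rfl
      map_smul' := fun _ _ => rfl }
  have : Module.Finite ℤ ((specDeg n k).comap (specialLie n).toSubmodule.subtype) :=
    Module.Finite.of_injective f fun D E h =>
      Subtype.ext (Subtype.ext (congrArg (fun F : specDeg n k => F.1) h))
  exact Module.Finite.map _ _

/-- The traces of the degree `k` part of the abelianization. -/
def traceImage (n k : ℕ) : Submodule ℤ (MvPolynomial (Fin n) ℤ) := (H1Deg n k).map (traceH1 n)

/-- The span of the monomials `x_i^{k-1} x_j` with `i ≤ j`. -/
def extremal (n k : ℕ) : Submodule ℤ (MvPolynomial (Fin n) ℤ) :=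
  Submodule.span ℤ (Set.range fun p : {p : Fin n × Fin n // p.1 ≤ p.2} =>
    X p.1.1 ^ (k - 1) * X p.1.2)

theorem two_mul_mem_traceImage {m : ℕ} (hm : Even m) {a y z : Fin n} (hy : y ≠ a) (hz : z ≠ a)
    (s : Multiset (Fin n)) (hs : s.card = m) :
    2 * ((s.map X).prod * (X a * X y * (X z + if y = z then X a else 0))) ∈
      traceImage n (m + 3) := by
  obtain ⟨l, rfl⟩ := Quot.exists_rep s
  have hl : l.length = m := hs
  have h := trace_mem_map (caterpillar_mem a (y :: (l ++ [z])) a)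
  rw [trace_caterpillar _ _ _ _ (hl ▸ hm) hy hz] at h
  have h' := neg_mem h
  rw [neg_neg, mul_assoc] at h'
  rw [List.length_cons, List.length_append, hl] at h'
  exact h'

theorem two_mul_pow_mul_pow_mem {m : ℕ} (hm : Even m) {a b : Fin n} (h : a < b) (j : ℕ) :
    ∀ i, 1 ≤ i → i + (j + 1) = m + 3 → (2 * (X a ^ i * X b ^ (j + 1)) : MvPolynomial (Fin n) ℤ) ∈
      traceImage n (m + 3) ⊔ extremal n (m + 3) := by
  induction j with
  | zero =>
    intro i hi hij
    refine Submodule.mem_sup_right ?_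
    have : (X a ^ (m + 3 - 1) * X b : MvPolynomial (Fin n) ℤ) ∈ extremal n (m + 3) :=
      Submodule.subset_span ⟨⟨(a, b), h.le⟩, rfl⟩
    rw [show m + 3 - 1 = i by omega] at this
    simpa [two_mul] using add_mem this this
  | succ j ih =>
    intro i hi hij
    obtain ⟨i, rfl⟩ := Nat.exists_eq_add_of_le' hi
    have h₁ := ih (i + 2) (by omega) (by omega)
    have h₂ := two_mul_mem_traceImage hm h.ne' h.ne'
      (Multiset.replicate i a + Multiset.replicate j b) (by simp; omega)
    convert sub_mem (Submodule.mem_sup_left (T := extremal n (m + 3)) h₂) h₁ using 1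
    simp
    ring

theorem two_mul_prod_mem {m : ℕ} (hm : Even m) (s : Multiset (Fin n)) (hs : s.card = m + 3) :
    2 * (s.map X).prod ∈ traceImage n (m + 3) ⊔ extremal n (m + 3) := by
  obtain ⟨a, ha⟩ := Multiset.card_pos_iff_exists_mem.1 (by omega : 0 < s.card)
  by_cases hsa : ∀ y ∈ s, y = a
  · rw [Multiset.eq_replicate.2 ⟨hs, hsa⟩]
    refine Submodule.mem_sup_right ?_
    have : (X a ^ (m + 3 - 1) * X a : MvPolynomial (Fin n) ℤ) ∈ extremal n (m + 3) :=
      Submodule.subset_span ⟨⟨(a, a), le_rfl⟩, rfl⟩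
    rw [← pow_succ] at this
    rw [Multiset.map_replicate, Multiset.prod_replicate, two_mul]
    exact add_mem this this
  push Not at hsa
  obtain ⟨y, hy, hya⟩ := hsa
  by_cases hsy : ∀ z ∈ s, z = a ∨ z = y
  · have key : s = Multiset.replicate (s.count a) a + Multiset.replicate (s.count y) y := by
      ext z
      rw [Multiset.count_add, Multiset.count_replicate, Multiset.count_replicate]
      by_cases hz : z ∈ s
      · obtain rfl | rfl := hsy z hz
        · simp [hya]
        · simp [hya.symm]
      · have h₁ : a ≠ z := fun h => hz (h ▸ ha)
        have h₂ : y ≠ z := fun h => hz (h ▸ hy)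
        simp [h₁, h₂, hz]
    have hcard := congrArg Multiset.card key
    simp only [Multiset.card_add, Multiset.card_replicate, hs] at hcard
    have ha' := Multiset.count_pos.2 ha
    have hy' := Multiset.count_pos.2 hy
    rw [key]
    simp only [Multiset.map_add, Multiset.map_replicate, Multiset.prod_add,
      Multiset.prod_replicate]
    obtain h | h := hya.lt_or_gt
    · rw [mul_comm (X a ^ _)]
      obtain ⟨j, hj⟩ := Nat.exists_eq_add_of_le' ha'
      rw [hj]
      exact two_mul_pow_mul_pow_mem hm h j _ hy' (by omega)
    · obtain ⟨j, hj⟩ := Nat.exists_eq_add_of_le' hy'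
      rw [hj]
      exact two_mul_pow_mul_pow_mem hm h j _ ha' (by omega)
  · push Not at hsy
    obtain ⟨z, hz, hza, hzy⟩ := hsy
    obtain ⟨t, rfl⟩ := Multiset.exists_cons_of_mem ha
    obtain ⟨t, rfl⟩ := Multiset.exists_cons_of_mem ((Multiset.mem_cons.1 hy).resolve_left hya)
    have hz' := (Multiset.mem_cons.1 ((Multiset.mem_cons.1 hz).resolve_left hza)).resolve_left hzy
    obtain ⟨t, rfl⟩ := Multiset.exists_cons_of_mem hz'
    have h := two_mul_mem_traceImage hm hya hza t (by simpa using hs)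
    convert Submodule.mem_sup_left (T := extremal n (m + 3)) h using 1
    simp [hzy.symm]
    ring

theorem linearIndependent_two_mul_prod (n k : ℕ) :
    LinearIndependent ℤ fun s : Sym (Fin n) k =>
      (2 * ((s : Multiset (Fin n)).map X).prod : MvPolynomial (Fin n) ℤ) := by
  have h := (basisMonomials (Fin n) ℤ).linearIndependent.comp
    (fun s : Sym (Fin n) k => Multiset.toFinsupp (s : Multiset (Fin n)))
    (Multiset.toFinsupp.injective.comp Sym.coe_injective)
  have h2 := h.map' (LinearMap.mulLeft ℤ (2 : MvPolynomial (Fin n) ℤ))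
    (LinearMap.ker_eq_bot.2 (mul_right_injective₀ two_ne_zero))
  convert h2 using 1
  · ext1 s
    simp only [Function.comp_apply, LinearMap.mulLeft_apply, coe_basisMonomials]
    congr 1
    generalize (s : Multiset (Fin n)) = t
    induction t using Multiset.induction_on with
    | empty => simp
    | cons a t ih =>
      rw [Multiset.map_cons, Multiset.prod_cons, ih, ← Multiset.singleton_add, map_add,
        Multiset.toFinsupp_singleton, X, monomial_mul, one_mul]
  · rfl
  · rfl
  · exact Subsingleton.elim _ _

theorem finrank_extremal_le (n k : ℕ) : Module.finrank ℤ (extremal n k) ≤ (n + 1).choose 2 := by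
  refine (finrank_range_le_card _).trans_eq ?_
  rw [← Fintype.card_congr Sym2.sortEquiv, Sym2.card, Fintype.card_fin]

theorem finrank_sup_le {V : Type*} [AddCommGroup V] (s t : Submodule ℤ V) [Module.Finite ℤ s]
    [Module.Finite ℤ t] [Module.Finite ℤ ↥(s ⊔ t)] :
    Module.finrank ℤ ↥(s ⊔ t) ≤ Module.finrank ℤ s + Module.finrank ℤ t := by
  have h := Submodule.rank_add_le_rank_add_rank s t
  rw [← Module.finrank_eq_rank, ← Module.finrank_eq_rank, ← Module.finrank_eq_rank] at h
  exact_mod_cast h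

theorem span_le_traceImage_sup {k : ℕ} (hk : 3 ≤ k) (hodd : Odd k) :
    Submodule.span ℤ (Set.range fun s : Sym (Fin n) k =>
      (2 * ((s : Multiset (Fin n)).map X).prod : MvPolynomial (Fin n) ℤ)) ≤
      traceImage n k ⊔ extremal n k := by
  have h (s : Multiset (Fin n)) (hs : s.card = k) :
      2 * (s.map X).prod ∈ traceImage n k ⊔ extremal n k := by
    obtain ⟨m, rfl⟩ := Nat.exists_eq_add_of_le' hk
    refine two_mul_prod_mem ?_ s hs
    by_contra h
    rw [Nat.not_even_iff_odd] at h
    exact Nat.not_even_iff_odd.2 hodd (h.add_odd (by decide))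
  rw [Submodule.span_le]
  rintro _ ⟨s, rfl⟩
  exact h s s.2

theorem choose_le_finrank_H1Deg (n : ℕ) {k : ℕ} (hk : 3 ≤ k) (hodd : Odd k) :
    (n + k - 1).choose k ≤ Module.finrank ℤ (H1Deg n k) + (n + 1).choose 2 := by
  have hfin : Module.Finite ℤ (traceImage n k) := Module.Finite.map _ _
  have hfin' : Module.Finite ℤ (extremal n k) :=
    Module.Finite.iff_fg.2 (Submodule.fg_span (Set.finite_range _))
  have hfin'' : Module.Finite ℤ ↥(traceImage n k ⊔ extremal n k) :=
    Module.Finite.iff_fg.2 ((Module.Finite.iff_fg.1 hfin).sup (Module.Finite.iff_fg.1 hfin'))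
  have h₁ := Submodule.finrank_mono (span_le_traceImage_sup (n := n) hk hodd)
  rw [finrank_span_eq_card (linearIndependent_two_mul_prod n k), Sym.card_sym_eq_choose,
    Fintype.card_fin] at h₁
  have h₂ : Module.finrank ℤ (traceImage n k) ≤ Module.finrank ℤ (H1Deg n k) :=
    Submodule.finrank_map_le _ _
  exact h₁.trans ((finrank_sup_le _ _).trans (add_le_add h₂ (finrank_extremal_le n k)))

theorem not_finite_H1 {n : ℕ} (hn : 3 ≤ n) : ¬ Module.Finite ℤ (H1 n) := by
  intro h
  obtain ⟨k, hk, hodd, hlt⟩ : ∃ k, 3 ≤ k ∧ Odd k ∧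
      Module.finrank ℤ (H1 n) + (n + 1).choose 2 < k :=
    ⟨2 * (Module.finrank ℤ (H1 n) + (n + 1).choose 2 + 1) + 1, by omega, odd_two_mul_add_one _,
      by omega⟩
  have h₁ := choose_le_finrank_H1Deg n hk hodd
  have h₂ := Submodule.finrank_le (H1Deg n k)
  have h₃ : (k + 1).choose k ≤ (n + k - 1).choose k := Nat.choose_le_choose _ (by omega)
  rw [Nat.choose_succ_self_right] at h₃
  omega

end SpecialDer

end

theorem mainTheorem2 (n : ℕ) (hn : 3 ≤ n) :
    (∀ k : ℕ, 3 ≤ k → Odd k →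
      ((n + k - 1).choose k : ℚ) - (n : ℚ) * (n + 1) / 2 ≤
        (Module.finrank ℤ (SpecialDer.H1Deg n k) : ℚ)) ∧
    ¬ Module.Finite ℤ (SpecialDer.H1 n) := by
  refine ⟨fun k hk hodd => ?_, SpecialDer.not_finite_H1 hn⟩
  have h : ((n + k - 1).choose k : ℚ) ≤
      Module.finrank ℤ (SpecialDer.H1Deg n k) + ((n + 1).choose 2 : ℕ) := by
    exact_mod_cast SpecialDer.choose_le_finrank_H1Deg n hk hodd
  rw [Nat.cast_choose_two] at h
  push_cast at h
  linarith
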